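/- All orders have field $\omega$, and a linear order $\le_L$ on $\omega$ is identified with the set $\{\langle x,y\rangle : x\le_L y\}\subseteq\omega$. A set $S\subseteq\omega$ is an ascending (respectively, descending) sequence for $\le_L$ if for all $x,y\in S$ with $x\le y$ we have $x\le_L y$ (respectively, $y\le_L x$); it is an ascending (respectively, descending) chain for $\le_L$ if for every $x\in S$ there are only finitely many $y\in S$ with $y\le_L x$ (respectively, $x\le_L y$). A problem consists of a class of instances $X\subseteq\omega$ and, for each instance, a class of solutions $Y\subseteq\omega$. Consider the following problems. - $\mathsf{ADS}$: an instance is a linear order on $\omega$, and a solution is an infinite ascending or descending sequence for it. - $\mathsf{ADC}$: an instance is a linear order on $\omega$, and a solution is an infinite ascending or descending chain for it. - $\mathsf{SADS}$: the restriction of $\mathsf{ADS}$ to linear orders of type $\omega+\omega^*$, that is, to those in which every $x$ is small (has only finitely many $y <_L x$) or large (has only finitely many $y$ with $x<_L y$), and in which there are infinitely many small and infinitely many large elements. A problem $\mathsf P$ is Weihrauch reducible to a problem $\mathsf Q$, written $\mathsf P\le_{\mathrm W}\mathsf Q$, if there are Turing functionals $\Phi$ and $\Delta$ such that for every instance $X$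 of $\mathsf P$, $\Phi^X$ is an instance of $\mathsf Q$, and for every solution $\widehat Y$ to $\Phi^X$, $\Delta^{X\oplus\widehat Y}$ is a solution to $X$. $\mathsf P$ is computably reducible to $\mathsf Q$, written $\mathsf P\le_{\mathrm c}\mathsf Q$, if every instance $X$ of $\mathsf P$ computes an instance $\widehat X$ of $\mathsf Q$ such that for every solution $\widehat Y$ to $\widehat X$ there is a solution to $X$ computable from $X\oplus\widehat Y$. **Theorem.** $\mathsf{SADS}\nleq_{\mathrm W}\mathsf{ADC}$. In particular, $\mathsf{ADS}\nleq_{\mathrm W}\mathsf{ADC}$, although $\mathsf{ADS}$ and $\mathsf{ADC}$ are computably equivalent, i.e. $\mathsf{ADS}\le_{\mathrm c}\mathsf{ADC}$ and $\mathsf{ADC}\le_{\mathrm c}\mathsf{ADS}$. -/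

import Mathlib

namespace Weihrauch

/-! ### Turing functionals -/

/-- Programs for partial functions `ℕ → ℕ` with access to an oracle. The constructors are the
clauses of `Nat.RecursiveIn`. -/
inductive OracleCode : Type
  | zero : OracleCode
  | succ : OracleCode
  | left : OracleCode
  | right : OracleCode
  | oracle : OracleCode
  | pair : OracleCode → OracleCode → OracleCode
  | comp : OracleCode → OracleCode → OracleCode
  | prec : OracleCode → OracleCode → OracleCode
  | rfind : OracleCode → OracleCode

/-- The partial function computed by a program when its oracle is `g`. -/
def OracleCode.eval (g : ℕ → ℕ) : OracleCode → ℕ →. ℕ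
  | .zero => fun _ => 0
  | .succ => Nat.succ
  | .left => fun n => (Nat.unpair n).1
  | .right => fun n => (Nat.unpair n).2
  | .oracle => g
  | .pair c d => fun n => Nat.pair <$> c.eval g n <*> d.eval g n
  | .comp c d => fun n => d.eval g n >>= c.eval g
  | .prec c d => fun p =>
      let (a, n) := Nat.unpair p
      n.rec (c.eval g a) fun y IH => do
        let i ← IH
        d.eval g (Nat.pair a (Nat.pair y i))
  | .rfind c => fun a => Nat.rfind fun n => (fun m => m = 0) <$> c.eval g (Nat.pair a n)

/-- For each fixed oracle, the programs compute exactly the partial functions that are recursive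
in this oracle. -/
theorem OracleCode.exists_eval_eq_iff (g : ℕ → ℕ) (f : ℕ →. ℕ) :
    (∃ c : OracleCode, c.eval g = f) ↔ Nat.RecursiveIn {(g : ℕ →. ℕ)} f := by
  constructor
  · rintro ⟨c, rfl⟩
    induction c with
    | zero => exact .zero
    | succ => exact .succ
    | left => exact .left
    | right => exact .right
    | oracle => exact .oracle _ rfl
    | pair c d hc hd => exact .pair hc hd
    | comp c d hc hd => exact .comp hc hd
    | prec c d hc hd => exact .prec hc hd
    | rfind c hc => exact .rfind hc
  · intro h
    induction h with
    | zero => exact ⟨.zero, rfl⟩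
    | succ => exact ⟨.succ, rfl⟩
    | left => exact ⟨.left, rfl⟩
    | right => exact ⟨.right, rfl⟩
    | oracle g' hg =>
      obtain rfl : g' = _ := hg
      exact ⟨.oracle, rfl⟩
    | pair _ _ hc hd =>
      obtain ⟨c, rfl⟩ := hc
      obtain ⟨d, rfl⟩ := hd
      exact ⟨.pair c d, rfl⟩
    | comp _ _ hc hd =>
      obtain ⟨c, rfl⟩ := hc
      obtain ⟨d, rfl⟩ := hd
      exact ⟨.comp c d, rfl⟩
    | prec _ _ hc hd =>
      obtain ⟨c, rfl⟩ := hc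
      obtain ⟨d, rfl⟩ := hd
      exact ⟨.prec c d, rfl⟩
    | rfind _ hc =>
      obtain ⟨c, rfl⟩ := hc
      exact ⟨.rfind c, rfl⟩

open Classical in
/-- The characteristic function of a set of natural numbers. -/
noncomputable def chi (X : Set ℕ) (n : ℕ) : ℕ := if n ∈ X then 1 else 0

/-- `Φ^X = Z`: with the oracle `X`, the functional `Φ` computes the characteristic function of
the set `Z`, so in particular it halts on every input. -/
def OracleCode.Computes (Φ : OracleCode) (X Z : Set ℕ) : Prop :=
  ∀ n : ℕ, Φ.eval (chi X) n = Part.some (chi Z n)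

/-- The set `Z` is computable from the set `X`. -/
def ComputableFrom (Z X : Set ℕ) : Prop :=
  TuringReducible (chi Z : ℕ →. ℕ) (chi X : ℕ →. ℕ)

/-- The join `X ⊕ Y`. -/
def join (X Y : Set ℕ) : Set ℕ :=
  {n | (∃ m ∈ X, n = 2 * m) ∨ (∃ m ∈ Y, n = 2 * m + 1)}

/-! ### Problems and reductions -/

/-- A problem: a collection of instances, and for each instance its solutions. (The relation
`Sol X Y` only matters for instances `X`.) -/
structure Problem where
  Inst : Set ℕ → Prop
  Sol : Set ℕ → Set ℕ → Prop

/-- Computable reducibility `P ≤_c Q`. -/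
def ComputablyReducible (P Q : Problem) : Prop :=
  ∀ X, P.Inst X → ∃ X', ComputableFrom X' X ∧ Q.Inst X' ∧
    ∀ Y', Q.Sol X' Y' → ∃ Y, ComputableFrom Y (join X Y') ∧ P.Sol X Y

/-- Weihrauch reducibility `P ≤_W Q`. -/
def WeihrauchReducible (P Q : Problem) : Prop :=
  ∃ Φ Δ : OracleCode, ∀ X, P.Inst X → ∃ X', Φ.Computes X X' ∧ Q.Inst X' ∧
    ∀ Y', Q.Sol X' Y' → ∃ Y, Δ.Computes (join X Y') Y ∧ P.Sol X Y

/-! ### Linear orders on `ℕ` -/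

/-- The binary relation on `ℕ` coded by a set of (codes of) pairs. -/
def Le (X : Set ℕ) (x y : ℕ) : Prop := Nat.pair x y ∈ X

/-- The strict relation `x <_L y`, that is, `x ≤_L y` and `x ≠ y`. -/
def Lt (X : Set ℕ) (x y : ℕ) : Prop := Le X x y ∧ x ≠ y

/-- The set `X` codes a linear order with field `ℕ`. -/
structure IsLinOrd (X : Set ℕ) : Prop where
  refl : ∀ x, Le X x x
  trans : ∀ x y z, Le X x y → Le X y z → Le X x z
  antisymm : ∀ x y, Le X x y → Le X y x → x = y
  total : ∀ x y, Le X x y ∨ Le X y x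

def AscendingSequence (X S : Set ℕ) : Prop := ∀ x ∈ S, ∀ y ∈ S, x ≤ y → Le X x y

def DescendingSequence (X S : Set ℕ) : Prop := ∀ x ∈ S, ∀ y ∈ S, x ≤ y → Le X y x

def AscendingChain (X S : Set ℕ) : Prop := ∀ x ∈ S, {y | y ∈ S ∧ Le X y x}.Finite

def DescendingChain (X S : Set ℕ) : Prop := ∀ x ∈ S, {y | y ∈ S ∧ Le X x y}.Finite

def Small (X : Set ℕ) (x : ℕ) : Prop := {y | Lt X y x}.Finite

def Large (X : Set ℕ) (x : ℕ) : Prop := {y | Lt X x y}.Finite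

/-- Every element is small or large. -/
def Stable (X : Set ℕ) : Prop := ∀ x, Small X x ∨ Large X x

/-- The ascending/descending sequence principle. -/
def ADS : Problem where
  Inst := IsLinOrd
  Sol X S := S.Infinite ∧ (AscendingSequence X S ∨ DescendingSequence X S)

/-- The ascending/descending chain principle. -/
def ADC : Problem where
  Inst := IsLinOrd
  Sol X S := S.Infinite ∧ (AscendingChain X S ∨ DescendingChain X S)

/-- The stable ascending/descending sequence principle: the restriction of `ADS` to stable linear
orders with infinitely many small and infinitely many large elements (order type `ω + ω*`). -/
def SADS : Problem where
  Inst X := IsLinOrd X ∧ Stable X ∧ {x | Small X x}.Infinite ∧ {x | Large X x}.Infinite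
  Sol := ADS.Sol

end Weihrauch

/-!
The two computable reductions are direct. An infinite ascending sequence is an ascending chain, and
an infinite ascending chain is thinned to an ascending sequence by selecting greedily, in numerical
order, the elements that lie above everything selected before (`greedySet_spec`); dually for
descending ones.

Suppose that `Φ` and `Δ` reduce `SADS` to `ADC`. An order `L` of type `ω + ω*` is built by
finite extension with commitments: at each stage finitely many elements have been declared small
or large, which fixes their predecessors or successors for good (`Extends`). Any other element can
still be put on either side without changing a given finite part of the order
(`exists_extends_large`), because all later numbers can be placed next to it.

Take any order `L` that satisfies the commitments made so far and an infinite chain `C` of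
`M = Φ^L`. Since `Δ` must succeed on every infinite subset of `C`, there are successive finite
blocks in `C` each of which already makes `Δ` output a pair `x < y`; among three blocks, two output
pairs of the same direction in `L` (`exists_two_blocks`). If both pairs ascend in `L`, commit `x`
to be large in both; if both descend, commit it to be small. No infinite ascending or descending
sequence can then contain either pair (`Spoiled.not_sol`), so in the order computed by `Φ` neither
block is part of an infinite chain whose other elements are numerically late. Let `F₁` lie below
`F₂` in `M`, and let `p` be the greatest element of `F₁`. An infinite ascending chain above `p`
would extend `F₁`, and an infinite descending chain below `p` would extend `F₂`. Hence `p` is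
forced to be isolated: it belongs to no infinite chain (`IsReduction.exists_forces_isolated`).

Repeating this infinitely often yields in the limit (`exists_limit`) an order `L` such that `Φ^L`
has infinitely many isolated elements. But a monotone sequence of such elements is itself a chain
to which its first term belongs, a contradiction (`IsLinOrd.not_forall_isolated`).
-/

namespace Weihrauch

/-! ### Oracle computations -/

/-- The use principle: a halting computation consults only finitely many values of its oracle. -/
theorem OracleCode.exists_use (c : OracleCode) (g : ℕ → ℕ) :
    ∀ n m, m ∈ c.eval g n → ∃ u, ∀ g' : ℕ → ℕ, (∀ i < u, g' i = g i) → m ∈ c.eval g' n := by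
  induction c with
  | zero => exact fun n m h => ⟨0, fun g' _ => h⟩
  | succ => exact fun n m h => ⟨0, fun g' _ => h⟩
  | left => exact fun n m h => ⟨0, fun g' _ => h⟩
  | right => exact fun n m h => ⟨0, fun g' _ => h⟩
  | oracle =>
    intro n m h
    refine ⟨n + 1, fun g' hg => ?_⟩
    simp only [OracleCode.eval, PFun.coe_val, Part.mem_some_iff] at h ⊢
    rw [h, hg n (by omega)]
  | pair c d hc hd =>
    intro n m h
    simp only [OracleCode.eval, Seq.seq, Part.map_eq_map, Part.mem_bind_iff, Part.mem_map_iff]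
      at h ⊢
    obtain ⟨_, ⟨a, ha, rfl⟩, b, hb, rfl⟩ := h
    obtain ⟨u, hu⟩ := hc n a ha
    obtain ⟨v, hv⟩ := hd n b hb
    exact ⟨max u v, fun g' hg => ⟨_, ⟨a, hu g' fun i hi => hg i (by omega), rfl⟩,
      b, hv g' fun i hi => hg i (by omega), rfl⟩⟩
  | comp c d hc hd =>
    intro n m h
    obtain ⟨a, ha, hm⟩ := Part.mem_bind_iff.1 h
    obtain ⟨u, hu⟩ := hd n a ha
    obtain ⟨v, hv⟩ := hc a m hm
    exact ⟨max u v, fun g' hg => Part.mem_bind_iff.2 ⟨a, hu g' fun i hi => hg i (by omega),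
      hv g' fun i hi => hg i (by omega)⟩⟩
  | prec c d hc hd =>
    intro p m h
    simp only [OracleCode.eval, Part.bind_eq_bind] at h ⊢
    generalize (Nat.unpair p).1 = a at h ⊢
    generalize (Nat.unpair p).2 = n at h ⊢
    induction n generalizing m with
    | zero => exact hc a m h
    | succ n ih =>
      simp only [Part.mem_bind_iff] at h ⊢
      obtain ⟨b, hb, hm⟩ := h
      obtain ⟨u, hu⟩ := ih b hb
      obtain ⟨v, hv⟩ := hd _ m hm
      exact ⟨max u v, fun g' hg => ⟨b, hu g' fun i hi => hg i (by omega),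
        hv g' fun i hi => hg i (by omega)⟩⟩
  | rfind c hc =>
    intro a m h
    obtain ⟨h0, hlt⟩ := Nat.mem_rfind.1 h
    obtain ⟨v, hv, hv0⟩ := (Part.mem_map_iff _).1 h0
    have key : ∀ j, ∃ u, j ≤ m → ∀ g' : ℕ → ℕ, (∀ i < u, g' i = g i) →
        ∀ w ∈ c.eval g (Nat.pair a j), w ∈ c.eval g' (Nat.pair a j) := by
      intro j
      by_cases hd : ∃ w, w ∈ c.eval g (Nat.pair a j)
      · obtain ⟨w, hw⟩ := hd
        obtain ⟨u, hu⟩ := hc _ w hw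
        refine ⟨u, fun _ g' hg w' hw' => ?_⟩
        rw [Part.mem_unique hw' hw]
        exact hu g' hg
      · exact ⟨0, fun _ g' _ w hw => absurd ⟨w, hw⟩ hd⟩
    choose u hu using key
    refine ⟨(Finset.range (m + 1)).sup u, fun g' hg => ?_⟩
    have tr : ∀ j ≤ m, ∀ w ∈ c.eval g (Nat.pair a j), w ∈ c.eval g' (Nat.pair a j) := by
      intro j hj
      refine hu j hj g' fun i hi => hg i (lt_of_lt_of_le hi ?_)
      exact Finset.le_sup (f := u) (Finset.mem_range.2 (by omega))
    refine Nat.mem_rfind.2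
      ⟨(Part.mem_map_iff _).2 ⟨v, tr m le_rfl v hv, hv0⟩, fun {j} hj => ?_⟩
    obtain ⟨w, hw, hw0⟩ := (Part.mem_map_iff _).1 (hlt hj)
    exact (Part.mem_map_iff _).2 ⟨w, tr j hj.le w hw, hw0⟩

theorem chi_eq_one_iff {X : Set ℕ} {n : ℕ} : chi X n = 1 ↔ n ∈ X := by
  unfold chi; split <;> simp_all

theorem chi_congr {X Y : Set ℕ} {n m : ℕ} (h : n ∈ X ↔ m ∈ Y) : chi X n = chi Y m := by
  by_cases hn : n ∈ X
  · rw [chi_eq_one_iff.2 hn, chi_eq_one_iff.2 (h.1 hn)]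
  · unfold chi; rw [if_neg hn, if_neg (mt h.2 hn)]

theorem two_mul_mem_join {X Y : Set ℕ} {n : ℕ} : 2 * n ∈ join X Y ↔ n ∈ X := by
  constructor
  · rintro (⟨m, hm, h⟩ | ⟨m, hm, h⟩)
    · obtain rfl : n = m := by omega
      exact hm
    · omega
  · exact fun h => Or.inl ⟨n, h, rfl⟩

theorem two_mul_add_one_mem_join {X Y : Set ℕ} {n : ℕ} : 2 * n + 1 ∈ join X Y ↔ n ∈ Y := by
  constructor
  · rintro (⟨m, hm, h⟩ | ⟨m, hm, h⟩)
    · omega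
    · obtain rfl : n = m := by omega
      exact hm
  · exact fun h => Or.inr ⟨n, h, rfl⟩

theorem mem_join_congr {X Y X' Y' : Set ℕ} {u : ℕ} (hX : ∀ i < u, (i ∈ X' ↔ i ∈ X))
    (hY : ∀ i < u, (i ∈ Y' ↔ i ∈ Y)) (i : ℕ) (hi : i < u) : i ∈ join X' Y' ↔ i ∈ join X Y := by
  obtain ⟨k, rfl | rfl⟩ := Nat.even_or_odd' i
  · rw [two_mul_mem_join, two_mul_mem_join, hX k (by omega)]
  · rw [two_mul_add_one_mem_join, two_mul_add_one_mem_join, hY k (by omega)]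

theorem OracleCode.Computes.unique {Φ : OracleCode} {X Z Z' : Set ℕ} (h : Φ.Computes X Z)
    (h' : Φ.Computes X Z') : Z = Z' := by
  ext n
  rw [← chi_eq_one_iff, ← chi_eq_one_iff, Part.some_inj.1 ((h n).symm.trans (h' n))]

/-- Finitely many output bits of a functional depend on a finite part of the oracle only. -/
theorem OracleCode.Computes.exists_use {Φ : OracleCode} {X Z : Set ℕ} (h : Φ.Computes X Z)
    (k : ℕ) : ∃ u, ∀ X' Z', (∀ i < u, (i ∈ X' ↔ i ∈ X)) → Φ.Computes X' Z' →
      ∀ n < k, (n ∈ Z' ↔ n ∈ Z) := by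
  have : ∀ n, ∃ u, ∀ g' : ℕ → ℕ, (∀ i < u, g' i = chi X i) → chi Z n ∈ Φ.eval g' n :=
    fun n => Φ.exists_use (chi X) n _ (by rw [h n]; exact Part.mem_some _)
  choose u hu using this
  refine ⟨(Finset.range k).sup u, fun X' Z' hX hZ n hn => ?_⟩
  have := hu n (chi X') fun i hi => chi_congr (hX i (hi.trans_le
    (Finset.le_sup (f := u) (Finset.mem_range.2 hn))))
  rw [hZ n, Part.mem_some_iff] at this
  rw [← chi_eq_one_iff, ← chi_eq_one_iff, this]

/-! ### Thinning a chain to a sequence -/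

theorem recursiveIn_comp {O : Set (ℕ →. ℕ)} {f h : ℕ → ℕ} (hf : Nat.RecursiveIn O (f : ℕ →. ℕ))
    (hh : Nat.RecursiveIn O (h : ℕ →. ℕ)) :
    Nat.RecursiveIn O ((fun n => f (h n) : ℕ → ℕ) : ℕ →. ℕ) :=
  (hf.comp hh).of_eq fun _ => Part.bind_some _ _

theorem recursiveIn_pair {O : Set (ℕ →. ℕ)} {f h : ℕ → ℕ} (hf : Nat.RecursiveIn O (f : ℕ →. ℕ))
    (hh : Nat.RecursiveIn O (h : ℕ →. ℕ)) :
    Nat.RecursiveIn O ((fun n => Nat.pair (f n) (h n) : ℕ → ℕ) : ℕ →. ℕ) :=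
  (hf.pair hh).of_eq fun n => by simp [Seq.seq]

theorem recursiveIn_iterate {O : Set (ℕ →. ℕ)} {f : ℕ → ℕ → ℕ}
    (hf : Nat.RecursiveIn O ((fun p => f p.unpair.1 p.unpair.2 : ℕ → ℕ) : ℕ →. ℕ)) :
    Nat.RecursiveIn O ((fun n => Nat.rec 0 f n : ℕ → ℕ) : ℕ →. ℕ) := by
  have h1 := Nat.RecursiveIn.prec (Nat.RecursiveIn.zero (O := O))
    (recursiveIn_comp hf (Nat.Primrec.right.recursiveIn (O := O)))
  have h2 : Nat.RecursiveIn O ((fun n => Nat.pair 0 n : ℕ → ℕ) : ℕ →. ℕ) :=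
    Nat.Primrec.recursiveIn (Primrec.nat_iff.1
      (Primrec₂.natPair.comp (Primrec.const 0) Primrec.id))
  refine (h1.comp h2).of_eq fun n => ?_
  simp only [PFun.coe_val, Part.bind_eq_bind, Part.bind_some, Nat.unpair_pair]
  induction n with
  | zero => rfl
  | succ n ih => simp only [ih, Part.bind_some]

/-- One step of the greedy thinning of `S`: the state `i` is `0` if nothing has been selected yet,
and `m + 1` if `m` was selected last; `n` is selected if it lies in `S` and `D m n` belongs to
`X`. -/
noncomputable def greedyStep (D : ℕ → ℕ → ℕ) (X S : Set ℕ) (n i : ℕ) : ℕ :=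
  if chi S n = 1 ∧ (i = 0 ∨ chi X (D (i - 1) n) = 1) then n + 1 else i

/-- The state of the greedy thinning of `S` before `n` is inspected. -/
noncomputable def greedyState (D : ℕ → ℕ → ℕ) (X S : Set ℕ) (n : ℕ) : ℕ :=
  Nat.rec 0 (greedyStep D X S) n

/-- The set of all numbers that the greedy thinning of `S` selects. -/
def greedySet (D : ℕ → ℕ → ℕ) (X S : Set ℕ) : Set ℕ := {n | greedyState D X S (n + 1) = n + 1}

theorem greedySet_computableFrom {D : ℕ → ℕ → ℕ} (hD : Primrec₂ D) (X S : Set ℕ) :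
    ComputableFrom (greedySet D X S) (join X S) := by
  let O : Set (ℕ →. ℕ) := {(chi (join X S) : ℕ →. ℕ)}
  have prim : ∀ {f : ℕ → ℕ}, Primrec f → Nat.RecursiveIn O (f : ℕ →. ℕ) :=
    fun hf => Nat.Primrec.recursiveIn (Primrec.nat_iff.1 hf)
  have orc : Nat.RecursiveIn O (chi (join X S) : ℕ →. ℕ) := .oracle _ rfl
  have fst : Primrec fun p : ℕ => p.unpair.1 := Primrec.fst.comp Primrec.unpair
  have snd : Primrec fun p : ℕ => p.unpair.2 := Primrec.snd.comp Primrec.unpair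
  have two : ∀ {f : ℕ → ℕ}, Primrec f → Primrec fun p => 2 * f p :=
    fun hf => Primrec.nat_mul.comp (Primrec.const 2) hf
  have hS : Nat.RecursiveIn O ((fun p => chi S p.unpair.1 : ℕ → ℕ) : ℕ →. ℕ) :=
    (recursiveIn_comp orc (prim (Primrec.succ.comp (two fst)))).of_eq fun p => by
      simp only [PFun.coe_val]
      exact congrArg _ (chi_congr two_mul_add_one_mem_join)
  have hX : Nat.RecursiveIn O
      ((fun p => chi X (D (p.unpair.2 - 1) p.unpair.1) : ℕ → ℕ) : ℕ →. ℕ) :=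
    (recursiveIn_comp orc (prim (two (hD.comp (Primrec.pred.comp snd) fst)))).of_eq fun p => by
      simp only [PFun.coe_val]
      exact congrArg _ (chi_congr two_mul_mem_join)
  have post : Primrec fun q : ℕ =>
      if q.unpair.2.unpair.1 = 1 ∧ (q.unpair.1.unpair.2 = 0 ∨ q.unpair.2.unpair.2 = 1)
      then q.unpair.1.unpair.1 + 1 else q.unpair.1.unpair.2 := by
    have c : ∀ {f : ℕ → ℕ} (k : ℕ), Primrec f → PrimrecPred fun p => f p = k :=
      fun k hf => Primrec.eq.comp hf (Primrec.const k)
    exact Primrec.ite ((c 1 (fst.comp snd)).and ((c 0 (snd.comp fst)).or (c 1 (snd.comp snd))))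
      (Primrec.succ.comp (fst.comp fst)) (snd.comp fst)
  have step : Nat.RecursiveIn O
      ((fun p => greedyStep D X S p.unpair.1 p.unpair.2 : ℕ → ℕ) : ℕ →. ℕ) :=
    (recursiveIn_comp (prim post)
      (recursiveIn_pair (prim Primrec.id) (recursiveIn_pair hS hX))).of_eq fun p => by
      simp [greedyStep]
  have state := recursiveIn_comp (recursiveIn_iterate step) (prim Primrec.succ)
  have last : Primrec fun q : ℕ => if q.unpair.1 = q.unpair.2 + 1 then 1 else 0 :=
    Primrec.ite (Primrec.eq.comp fst (Primrec.succ.comp snd)) (Primrec.const 1) (Primrec.const 0)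
  refine Nat.RecursiveIn.of_eq (recursiveIn_comp (prim last)
    (recursiveIn_pair state (prim Primrec.id))) fun n => ?_
  simp [chi, greedySet, greedyState]

open Classical in
/-- If `D a b ∈ X` expresses a reflexive and transitive relation, each `x ∈ S` being related to all but
finitely many elements of `S`, then the greedy thinning of `S` is infinite and monotone. -/
theorem greedySet_spec {D : ℕ → ℕ → ℕ} {X S : Set ℕ}
    (htrans : ∀ a b c, D a b ∈ X → D b c ∈ X → D a c ∈ X) (hrefl : ∀ a, D a a ∈ X)
    (hS : S.Infinite) (hfin : ∀ x ∈ S, {y | y ∈ S ∧ D x y ∉ X}.Finite) :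
    (greedySet D X S).Infinite ∧
      ∀ x ∈ greedySet D X S, ∀ y ∈ greedySet D X S, x ≤ y → D x y ∈ X := by
  set st := greedyState D X S
  have hsucc : ∀ n, st (n + 1) =
      if n ∈ S ∧ (st n = 0 ∨ D (st n - 1) n ∈ X) then n + 1 else st n := by
    intro n
    change greedyStep D X S n (st n) = _
    simp only [greedyStep, chi_eq_one_iff]
  have hle : ∀ n, st n ≤ n := by
    intro n
    induction n with
    | zero => exact le_rfl
    | succ n ih => rw [hsucc]; split_ifs <;> omega
  have hmem : ∀ n, n ∈ greedySet D X S ↔ n ∈ S ∧ (st n = 0 ∨ D (st n - 1) n ∈ X) := by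
    intro n
    change st (n + 1) = n + 1 ↔ _
    rw [hsucc]
    have := hle n
    split_ifs with h
    · simp [h]
    · simp only [h, iff_false]; omega
  have hstS : ∀ n, st n ≠ 0 → st n - 1 ∈ S := by
    intro n
    induction n with
    | zero => exact fun h => absurd rfl h
    | succ n ih =>
      rw [hsucc]
      split_ifs with h
      · exact fun _ => h.1
      · exact ih
  have hinv : ∀ n, ∀ x ∈ greedySet D X S, x < n → st n ≠ 0 ∧ D x (st n - 1) ∈ X := by
    intro n
    induction n with
    | zero => intro x _ h; omega
    | succ n ih =>
      intro x hx hxn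
      rcases Nat.lt_succ_iff_lt_or_eq.1 hxn with h | rfl
      · obtain ⟨h0, h1⟩ := ih x hx h
        rw [hsucc]
        split_ifs with hn
        · exact ⟨by omega, htrans _ _ _ h1 (hn.2.resolve_left h0)⟩
        · exact ⟨h0, h1⟩
      · rw [hsucc, if_pos ((hmem x).1 hx)]
        exact ⟨by omega, hrefl x⟩
  refine ⟨fun hfinite => ?_, fun x hx y hy hxy => ?_⟩
  · obtain ⟨N, hN⟩ := hfinite.bddAbove
    have hconst : ∀ k, st (N + 1 + k) = st (N + 1) := by
      intro k
      induction k with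
      | zero => rfl
      | succ k ih =>
        rw [← add_assoc, hsucc, if_neg, ih]
        intro h
        have := hN ((hmem _).2 h)
        omega
    have hbad : ∀ y ∈ S, N + 1 ≤ y → st (N + 1) ≠ 0 ∧ D (st (N + 1) - 1) y ∉ X := by
      intro y hy hNy
      obtain ⟨k, rfl⟩ := Nat.exists_eq_add_of_le hNy
      rw [← hconst k]
      by_contra hcon
      have := hN ((hmem (N + 1 + k)).2 ⟨hy, by tauto⟩)
      omega
    have hinf : (S \ Set.Iio (N + 1)).Infinite := hS.sdiff (Set.finite_Iio _)
    obtain ⟨y, hy, hyN⟩ := hinf.nonempty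
    have h0 := (hbad y hy (by simpa using hyN)).1
    exact hinf ((hfin _ (hstS _ h0)).subset fun z hz =>
      ⟨hz.1, (hbad z hz.1 (by simpa using hz.2)).2⟩)
  · rcases hxy.lt_or_eq with h | rfl
    · obtain ⟨h0, h1⟩ := hinv y x hx h
      exact htrans _ _ _ h1 (((hmem y).1 hy).2.resolve_left h0)
    · exact hrefl x

theorem ads_computablyReducible_adc : ComputablyReducible ADS ADC := by
  intro X hX
  have hL : IsLinOrd X := hX
  refine ⟨X, TuringReducible.refl _, hX, fun S hS => ?_⟩
  obtain ⟨hinf, hasc | hdesc⟩ := hS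
  · obtain ⟨h1, h2⟩ := greedySet_spec (D := Nat.pair) hL.trans hL.refl hinf fun x hx =>
      (hasc x hx).subset fun y hy => ⟨hy.1, (hL.total x y).resolve_left hy.2⟩
    exact ⟨_, greedySet_computableFrom Primrec₂.natPair X S, h1, .inl h2⟩
  · obtain ⟨h1, h2⟩ := greedySet_spec (D := fun a b => Nat.pair b a) (X := X)
      (fun a b c hab hbc => hL.trans c b a hbc hab) hL.refl hinf fun x hx =>
      (hdesc x hx).subset fun y hy => ⟨hy.1, (hL.total x y).resolve_right hy.2⟩
    exact ⟨_, greedySet_computableFrom Primrec₂.natPair.swap X S, h1, .inr h2⟩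

theorem adc_computablyReducible_ads : ComputablyReducible ADC ADS := by
  intro X hX
  have hL : IsLinOrd X := hX
  refine ⟨X, TuringReducible.refl _, hX, fun S hS => ⟨S, ?_, hS.1, ?_⟩⟩
  · have hodd : Nat.RecursiveIn {(chi (join X S) : ℕ →. ℕ)}
        ((fun n => 2 * n + 1 : ℕ → ℕ) : ℕ →. ℕ) :=
      Nat.Primrec.recursiveIn (Primrec.nat_iff.1
        (Primrec.succ.comp (Primrec.nat_mul.comp (Primrec.const 2) Primrec.id)))
    refine Nat.RecursiveIn.of_eq (recursiveIn_comp (.oracle _ rfl) hodd) fun n => ?_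
    simpa using chi_congr two_mul_add_one_mem_join
  -- an element of an ascending sequence has only numerically smaller elements below it
  · refine hS.2.imp (fun h x hx => ?_) (fun h x hx => ?_)
    · refine (Set.finite_Iic x).subset fun y hy => Set.mem_Iic.2 <| not_lt.1 fun hxy => hxy.ne ?_
      exact hL.antisymm x y (h x hx y hy.1 hxy.le) hy.2
    · refine (Set.finite_Iic x).subset fun y hy => Set.mem_Iic.2 <| not_lt.1 fun hxy => hxy.ne ?_
      exact hL.antisymm x y hy.2 (h x hx y hy.1 hxy.le)

/-! ### Orders of type `ω + ω*` -/

/-- The reverse of the relation coded by `X`. -/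
def rev (X : Set ℕ) : Set ℕ := {p | Nat.pair p.unpair.2 p.unpair.1 ∈ X}

theorem le_rev {X : Set ℕ} {x y : ℕ} : Le (rev X) x y ↔ Le X y x := by
  simp [Le, rev]

theorem rev_rev (X : Set ℕ) : rev (rev X) = X := by
  ext p; simp [rev]

theorem small_iff {X : Set ℕ} {x : ℕ} : Small X x ↔ {y | Le X y x}.Finite := by
  refine ⟨fun h => (h.insert x).subset fun y hy => ?_, fun h => h.subset fun y hy => hy.1⟩
  by_cases e : y = x
  · exact Or.inl e
  · exact Or.inr ⟨hy, e⟩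

theorem large_iff {X : Set ℕ} {x : ℕ} : Large X x ↔ {y | Le X x y}.Finite := by
  refine ⟨fun h => (h.insert x).subset fun y hy => ?_, fun h => h.subset fun y hy => hy.1⟩
  by_cases e : y = x
  · exact Or.inl e
  · exact Or.inr ⟨hy, Ne.symm e⟩

theorem small_rev {X : Set ℕ} {x : ℕ} : Small (rev X) x ↔ Large X x := by
  simp only [small_iff, large_iff, le_rev]

theorem large_rev {X : Set ℕ} {x : ℕ} : Large (rev X) x ↔ Small X x := by
  simp only [small_iff, large_iff, le_rev]

theorem IsLinOrd.rev {X : Set ℕ} (h : IsLinOrd X) : IsLinOrd (rev X) where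
  refl x := le_rev.2 (h.refl x)
  trans x y z hxy hyz := le_rev.2 (h.trans z y x (le_rev.1 hyz) (le_rev.1 hxy))
  antisymm x y hxy hyx := h.antisymm x y (le_rev.1 hyx) (le_rev.1 hxy)
  total x y := by simpa only [le_rev] using h.total y x

theorem sads_inst_rev {X : Set ℕ} (h : SADS.Inst X) : SADS.Inst (rev X) := by
  obtain ⟨h1, h2, h3, h4⟩ := h
  refine ⟨h1.rev, fun x => ?_, ?_, ?_⟩
  · rw [small_rev, large_rev]; exact (h2 x).symm
  · simpa only [small_rev] using h4
  · simpa only [large_rev] using h3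

theorem exists_sads_inst : ∃ X, SADS.Inst X := by
  -- the even numbers in increasing order, followed by the odd numbers in decreasing order
  let R : ℕ → ℕ → Prop := fun a b =>
    (a % 2 = 0 ∧ b % 2 = 0 ∧ a ≤ b) ∨ (a % 2 = 0 ∧ b % 2 = 1) ∨ (a % 2 = 1 ∧ b % 2 = 1 ∧ b ≤ a)
  let X : Set ℕ := {p | R p.unpair.1 p.unpair.2}
  have hX : ∀ a b, Le X a b ↔ R a b := fun a b => by simp [Le, X]
  have hs : ∀ x, x % 2 = 0 → Small X x := fun x hx => small_iff.2 <|
    (Set.finite_Iic x).subset fun y hy => by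
      have := (hX y x).1 hy
      simp only [R] at this
      simp only [Set.mem_Iic]
      omega
  have hl : ∀ x, x % 2 = 1 → Large X x := fun x hx => large_iff.2 <|
    (Set.finite_Iic x).subset fun y hy => by
      have := (hX x y).1 hy
      simp only [R] at this
      simp only [Set.mem_Iic]
      omega
  refine ⟨X, ⟨fun x => ?_, fun x y z => ?_, fun x y => ?_, fun x y => ?_⟩, fun x => ?_, ?_, ?_⟩
  · rw [hX]; simp only [R]; omega
  · rw [hX, hX, hX]; simp only [R]; omega
  · rw [hX, hX]; simp only [R]; omega
  · rw [hX, hX]; simp only [R]; omega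
  · exact (Nat.mod_two_eq_zero_or_one x).imp (hs x) (hl x)
  · exact Set.infinite_of_forall_exists_gt fun a => ⟨2 * (a + 1), hs _ (by omega), by omega⟩
  · exact Set.infinite_of_forall_exists_gt fun a => ⟨2 * a + 1, hl _ (by omega), by omega⟩

/-! ### Extensions that respect finitely many commitments -/

/-- `L'` keeps the commitments that `L` makes on the numbers below `n`: a small element of `L`
below `n` receives no new predecessors, and a large one no new successors. -/
structure Extends (n : ℕ) (L L' : Set ℕ) : Prop where
  small : ∀ x < n, Small L x → ∀ y, Le L' y x ↔ Le L y x
  large : ∀ x < n, Large L x → ∀ y, Le L' x y ↔ Le L x y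

theorem Extends.refl (n : ℕ) (L : Set ℕ) : Extends n L L :=
  ⟨fun _ _ _ _ => Iff.rfl, fun _ _ _ _ => Iff.rfl⟩

theorem Extends.small_of_small {n : ℕ} {L L' : Set ℕ} (h : Extends n L L') {x : ℕ} (hx : x < n)
    (hs : Small L x) : Small L' x := by
  rw [small_iff] at hs ⊢
  simpa only [h.small x hx (small_iff.2 hs)] using hs

theorem Extends.large_of_large {n : ℕ} {L L' : Set ℕ} (h : Extends n L L') {x : ℕ} (hx : x < n)
    (hs : Large L x) : Large L' x := by
  rw [large_iff] at hs ⊢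
  simpa only [h.large x hx (large_iff.2 hs)] using hs

theorem Extends.trans {n n' : ℕ} {L L' L'' : Set ℕ} (h : Extends n L L')
    (h' : Extends n' L' L'') (hn : n ≤ n') : Extends n L L'' where
  small x hx hs y := by
    rw [h'.small x (hx.trans_le hn) (h.small_of_small hx hs), h.small x hx hs]
  large x hx hs y := by
    rw [h'.large x (hx.trans_le hn) (h.large_of_large hx hs), h.large x hx hs]

theorem Extends.rev {n : ℕ} {L L' : Set ℕ} (h : Extends n L L') :
    Extends n (rev L) (rev L') where
  small x hx hs y := by rw [le_rev, le_rev]; exact h.large x hx (small_rev.1 hs) y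
  large x hx hs y := by rw [le_rev, le_rev]; exact h.small x hx (large_rev.1 hs) y

theorem Extends.le_iff {n : ℕ} {L L' : Set ℕ} (h : Extends n L L') (hL : SADS.Inst L)
    (hL' : SADS.Inst L') {x y : ℕ} (hx : x < n) (hy : y < n) : Le L' x y ↔ Le L x y := by
  rcases hL.2.1 x with hs | hs
  · -- by linearity, `x ≤ y` is decided by `y ≤ x`, and `x` has the same predecessors in both
    have key := h.small x hx hs y
    by_cases e : x = y
    · subst e; exact key
    · exact ⟨fun h1 => (hL.1.total x y).resolve_right
          fun h2 => e (hL'.1.antisymm x y h1 (key.2 h2)),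
        fun h1 => (hL'.1.total x y).resolve_right
          fun h2 => e (hL.1.antisymm x y h1 (key.1 h2))⟩
  · exact h.large x hx hs y

theorem Extends.mem_iff {n : ℕ} {L L' : Set ℕ} (h : Extends n L L') (hL : SADS.Inst L)
    (hL' : SADS.Inst L') {p : ℕ} (hp : p < n) : p ∈ L' ↔ p ∈ L := by
  have := h.le_iff hL hL' ((Nat.unpair_left_le p).trans_lt hp) ((Nat.unpair_right_le p).trans_lt hp)
  simpa only [Le, Nat.pair_unpair] using this

/-- The numbers whose position is determined by the commitments of `L` below `n`. -/
def committed (L : Set ℕ) (n : ℕ) : Set ℕ :=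
  {y | ∃ s < n, (Small L s ∧ Le L y s) ∨ (Large L s ∧ Le L s y)}

theorem committed_finite (L : Set ℕ) (n : ℕ) : (committed L n).Finite := by
  have : committed L n = ⋃ s ∈ Set.Iio n,
      ({y | Small L s ∧ Le L y s} ∪ {y | Large L s ∧ Le L s y}) := by
    ext y; simp [committed]
  rw [this]
  refine (Set.finite_Iio n).biUnion fun s _ => Set.Finite.union ?_ ?_
  · by_cases h : Small L s
    · exact (small_iff.1 h).subset fun y hy => hy.2
    · simp [h]
  · by_cases h : Large L s
    · exact (large_iff.1 h).subset fun y hy => hy.2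
    · simp [h]

theorem committed_rev (L : Set ℕ) (n : ℕ) : committed (rev L) n = committed L n := by
  ext y
  simp only [committed, Set.mem_ofPred_eq, small_rev, large_rev, le_rev, or_comm]

/-- An element without commitment can be made large, without changing any finite part of the
order: all sufficiently late numbers are moved directly below it. -/
theorem exists_extends_large {L : Set ℕ} (hL : SADS.Inst L) {n x : ℕ} (hx : x ∉ committed L n)
    (N₀ : ℕ) : ∃ L', SADS.Inst L' ∧ Extends n L L' ∧
      (∀ a < N₀, ∀ b < N₀, (Le L' a b ↔ Le L a b)) ∧ Large L' x := by
  obtain ⟨hlin, hst, hsi, hli⟩ := hL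
  obtain ⟨refl, trans, antisymm, total⟩ := hlin
  obtain ⟨B, hB⟩ := (committed_finite L n).bddAbove
  obtain ⟨N, hN0, hNx, hNn, hNB⟩ : ∃ N, N₀ ≤ N ∧ x < N ∧ n ≤ N ∧ B < N :=
    ⟨N₀ + x + n + B + 1, by omega, by omega, by omega, by omega⟩
  have hlow : ∀ s < n, Small L s → ¬ Le L x s := fun s hs h h' => hx ⟨s, hs, .inl ⟨h, h'⟩⟩
  have hhigh : ∀ s < n, Large L s → Le L x s := fun s hs h =>
    (total x s).resolve_right fun h' => hx ⟨s, hs, .inr ⟨h, h'⟩⟩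
  let R : ℕ → ℕ → Prop := fun a b => (a < N ∧ b < N ∧ Le L a b) ∨ (N ≤ a ∧ N ≤ b ∧ Le L a b) ∨
    (a < N ∧ N ≤ b ∧ ¬ Le L x a) ∨ (N ≤ a ∧ b < N ∧ Le L x b)
  let L' : Set ℕ := {p | R p.unpair.1 p.unpair.2}
  have hR : ∀ a b, Le L' a b ↔ R a b := fun a b => by simp [Le, L']
  have hll : ∀ a b, a < N → b < N → (R a b ↔ Le L a b) := fun a b ha hb => by
    simp only [R]; grind
  have huu : ∀ a b, N ≤ a → N ≤ b → (R a b ↔ Le L a b) := fun a b ha hb => by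
    simp only [R]; grind
  have hlu : ∀ a b, a < N → N ≤ b → (R a b ↔ ¬ Le L x a) := fun a b ha hb => by
    simp only [R]; grind
  have hul : ∀ a b, N ≤ a → b < N → (R a b ↔ Le L x b) := fun a b ha hb => by
    simp only [R]; grind
  have hup : ∀ a, a < N → Le L x a → Large L' a := fun a ha h => large_iff.2 <|
    (Set.finite_Iio N).subset fun b hb => not_le.1 fun hb' =>
      (hlu a b ha hb').1 ((hR a b).1 hb) h
  have hdown : ∀ a, a < N → ¬ Le L x a → Small L' a := fun a ha h => small_iff.2 <|
    (Set.finite_Iio N).subset fun b hb => not_le.1 fun hb' =>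
      h ((hul b a hb' ha).1 ((hR b a).1 hb))
  have hsm : ∀ a, N ≤ a → Small L a → Small L' a := fun a ha h => small_iff.2 <|
    ((Set.finite_Iio N).union (small_iff.1 h)).subset fun b hb => by
      rcases lt_or_ge b N with hb' | hb'
      · exact .inl hb'
      · exact .inr ((huu b a hb' ha).1 ((hR b a).1 hb))
  have hla : ∀ a, N ≤ a → Large L a → Large L' a := fun a ha h => large_iff.2 <|
    ((Set.finite_Iio N).union (large_iff.1 h)).subset fun b hb => by
      rcases lt_or_ge b N with hb' | hb'
      · exact .inl hb'
      · exact .inr ((huu a b ha hb').1 ((hR a b).1 hb))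
  refine ⟨L', ⟨⟨fun a => ?_, fun a b c => ?_, fun a b => ?_, fun a b => ?_⟩, fun a => ?_, ?_, ?_⟩,
    ⟨fun s hs h y => ?_, fun s hs h y => ?_⟩, fun a ha b hb => ?_, hup x hNx (refl x)⟩
  · have := refl a
    rw [hR]; grind
  · have h1 := trans a b c
    have h2 := trans x a b
    have h3 := trans x b c
    have h4 := trans x c b
    have h5 := trans x b a
    have h6 := total x b
    have h7 := total x a
    have h8 := total x c
    have h9 := trans a x c
    simp only [hR, R]; grind
  · have := antisymm a b
    simp only [hR, R]; grind
  · have := total a b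
    simp only [hR, R]; grind
  · rcases lt_or_ge a N with ha | ha
    · by_cases h : Le L x a
      · exact .inr (hup a ha h)
      · exact .inl (hdown a ha h)
    · exact (hst a).imp (hsm a ha) (hla a ha)
  · exact (hsi.sdiff (Set.finite_Iio N)).mono fun a ha => hsm a (not_lt.1 ha.2) ha.1
  · exact (hli.sdiff (Set.finite_Iio N)).mono fun a ha => hla a (not_lt.1 ha.2) ha.1
  · rw [hR]
    rcases lt_or_ge y N with hy | hy
    · exact hll y s hy (by omega)
    · rw [hul y s hy (by omega)]
      refine iff_of_false (hlow s hs h) fun h' => ?_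
      have := hB (show y ∈ committed L n from ⟨s, hs, .inl ⟨h, h'⟩⟩)
      omega
  · rw [hR]
    rcases lt_or_ge y N with hy | hy
    · exact hll s y (by omega) hy
    · rw [hlu s y (by omega) hy]
      refine iff_of_false (fun h' => h' (hhigh s hs h)) fun h' => ?_
      have := hB (show y ∈ committed L n from ⟨s, hs, .inr ⟨h, h'⟩⟩)
      omega
  · rw [hR]; exact hll a b (by omega) (by omega)

theorem exists_extends_small {L : Set ℕ} (hL : SADS.Inst L) {n x : ℕ} (hx : x ∉ committed L n)
    (N₀ : ℕ) : ∃ L', SADS.Inst L' ∧ Extends n L L' ∧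
      (∀ a < N₀, ∀ b < N₀, (Le L' a b ↔ Le L a b)) ∧ Small L' x := by
  obtain ⟨L', h1, h2, h3, h4⟩ :=
    exists_extends_large (sads_inst_rev hL) (by rwa [committed_rev]) N₀
  refine ⟨rev L', sads_inst_rev h1, by simpa only [rev_rev] using h2.rev, fun a ha b hb => ?_,
    small_rev.2 h4⟩
  rw [le_rev, h3 b hb a ha, le_rev]

/-- The limit of a sequence of orders with more and more commitments. -/
theorem exists_limit {L : ℕ → Set ℕ} {n : ℕ → ℕ} (hL : ∀ i, SADS.Inst (L i))
    (hn : ∀ i, n i < n (i + 1)) (hext : ∀ i, Extends (n i) (L i) (L (i + 1)))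
    (hsmall : ∀ i, ∃ s, n i ≤ s ∧ s < n (i + 1) ∧ Small (L (i + 1)) s)
    (hlarge : ∀ i, ∃ s, n i ≤ s ∧ s < n (i + 1) ∧ Large (L (i + 1)) s) :
    ∃ K, SADS.Inst K ∧ ∀ i, Extends (n i) (L i) K := by
  have hmono : StrictMono n := strictMono_nat_of_lt_succ hn
  have hge : ∀ i, i ≤ n i := fun _ => hmono.le_apply
  have hij : ∀ i j, i ≤ j → Extends (n i) (L i) (L j) := by
    intro i j h
    induction j, h using Nat.le_induction with
    | base => exact Extends.refl _ _
    | succ j h ih => exact ih.trans (hext j) (hmono.monotone h)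
  have hagree : ∀ i j a b, a < n i → b < n i → a < n j → b < n j →
      (Le (L i) a b ↔ Le (L j) a b) := by
    intro i j a b h1 h2 h3 h4
    rcases le_total i j with h | h
    · exact ((hij i j h).le_iff (hL i) (hL j) h1 h2).symm
    · exact (hij j i h).le_iff (hL j) (hL i) h3 h4
  let K : Set ℕ := {p | p ∈ L (p + 1)}
  have hK : ∀ i a b, a < n i → b < n i → (Le K a b ↔ Le (L i) a b) := by
    intro i a b ha hb
    have h1 := hge (Nat.pair a b + 1)
    have h2 := Nat.left_le_pair a b
    have h3 := Nat.right_le_pair a b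
    exact hagree _ i a b (by omega) (by omega) ha hb
  have hKext : ∀ i, Extends (n i) (L i) K := by
    intro i
    have main : ∀ x < n i, ∀ y, ∃ j, i ≤ j ∧ (Le K x y ↔ Le (L j) x y) ∧
        (Le K y x ↔ Le (L j) y x) := by
      intro x hx y
      have h1 := hge (i + y + 1)
      have h2 := hmono.monotone (show i ≤ i + y + 1 by omega)
      exact ⟨i + y + 1, by omega, hK _ _ _ (by omega) (by omega), hK _ _ _ (by omega) (by omega)⟩
    refine ⟨fun x hx hs y => ?_, fun x hx hs y => ?_⟩
    · obtain ⟨j, h, -, e⟩ := main x hx y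
      rw [e, (hij i j h).small x hx hs]
    · obtain ⟨j, h, e, -⟩ := main x hx y
      rw [e, (hij i j h).large x hx hs]
  refine ⟨K, ⟨⟨fun x => ?_, fun x y z => ?_, fun x y => ?_, fun x y => ?_⟩, fun x => ?_,
    Set.infinite_of_forall_exists_gt fun i => ?_, Set.infinite_of_forall_exists_gt fun i => ?_⟩,
    hKext⟩
  · have := hge (x + 1)
    rw [hK (x + 1) x x (by omega) (by omega)]
    exact (hL _).1.refl x
  · have := hge (x + y + z + 1)
    rw [hK (x + y + z + 1) x y (by omega) (by omega), hK (x + y + z + 1) y z (by omega) (by omega),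
      hK (x + y + z + 1) x z (by omega) (by omega)]
    exact (hL _).1.trans x y z
  · have := hge (x + y + 1)
    rw [hK (x + y + 1) x y (by omega) (by omega), hK (x + y + 1) y x (by omega) (by omega)]
    exact (hL _).1.antisymm x y
  · have := hge (x + y + 1)
    rw [hK (x + y + 1) x y (by omega) (by omega), hK (x + y + 1) y x (by omega) (by omega)]
    exact (hL _).1.total x y
  · have : x < n (x + 1) := hge (x + 1)
    exact ((hL (x + 1)).2.1 x).imp ((hKext _).small_of_small this) ((hKext _).large_of_large this)
  · obtain ⟨s, h1, h2, h3⟩ := hsmall (i + 1)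
    exact ⟨s, (hKext _).small_of_small h2 h3, (hge (i + 1)).trans h1⟩
  · obtain ⟨s, h1, h2, h3⟩ := hlarge (i + 1)
    exact ⟨s, (hKext _).large_of_large h2 h3, (hge (i + 1)).trans h1⟩

/-! ### Chains -/

theorem IsLinOrd.exists_greatest {M : Set ℕ} (hM : IsLinOrd M) {F : Set ℕ} (hF : F.Finite)
    (hne : F.Nonempty) : ∃ p ∈ F, ∀ a ∈ F, Le M a p := by
  induction F, hF using Set.Finite.induction_on with
  | empty => exact absurd hne Set.not_nonempty_empty
  | @insert b F _ _ ih =>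
    rcases F.eq_empty_or_nonempty with rfl | hF
    · exact ⟨b, .inl rfl, fun a ha => by
        obtain rfl : a = b := by simpa using ha
        exact hM.refl a⟩
    · obtain ⟨p, hp, hmax⟩ := ih hF
      rcases hM.total b p with h | h
      · exact ⟨p, .inr hp, fun a ha => ha.elim (fun e => e ▸ h) (hmax a)⟩
      · exact ⟨b, .inl rfl, fun a ha => ha.elim (fun e => e ▸ hM.refl b)
          fun ha => hM.trans _ _ _ (hmax a ha) h⟩

theorem IsLinOrd.exists_monotone_subseq {M : Set ℕ} (hM : IsLinOrd M) {f : ℕ → ℕ}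
    (hf : StrictMono f) : ∃ h : ℕ → ℕ, StrictMono h ∧ (∀ i, h i ∈ Set.range f) ∧
      ((∀ m n, m < n → Le M (h m) (h n)) ∨ (∀ m n, m < n → Le M (h n) (h m))) := by
  have : IsTrans ℕ (Le M) := ⟨hM.trans⟩
  obtain ⟨g, hg⟩ := exists_increasing_or_nonincreasing_subseq (Le M) f
  exact ⟨f ∘ g, hf.comp g.strictMono, fun i => ⟨_, rfl⟩, hg.imp id
    fun h m n hmn => (hM.total _ _).resolve_left (h m n hmn)⟩

theorem IsLinOrd.ascendingChain_range {M : Set ℕ} (hM : IsLinOrd M) {h : ℕ → ℕ}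
    (hh : StrictMono h) (hle : ∀ m n, m < n → Le M (h m) (h n)) :
    AscendingChain M (Set.range h) := by
  rintro _ ⟨m, rfl⟩
  refine ((Set.finite_Iic m).image h).subset ?_
  rintro _ ⟨⟨k, rfl⟩, hk⟩
  exact ⟨k, not_lt.1 fun hmk => (hh hmk).ne (hM.antisymm _ _ (hle m k hmk) hk), rfl⟩

theorem IsLinOrd.descendingChain_range {M : Set ℕ} (hM : IsLinOrd M) {h : ℕ → ℕ}
    (hh : StrictMono h) (hle : ∀ m n, m < n → Le M (h n) (h m)) :
    DescendingChain M (Set.range h) := by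
  rintro _ ⟨m, rfl⟩
  refine ((Set.finite_Iic m).image h).subset ?_
  rintro _ ⟨⟨k, rfl⟩, hk⟩
  exact ⟨k, not_lt.1 fun hmk => (hh hmk).ne (hM.antisymm _ _ hk (hle m k hmk)), rfl⟩

theorem IsLinOrd.exists_adc_sol {M : Set ℕ} (hM : IsLinOrd M) : ∃ C, ADC.Sol M C := by
  obtain ⟨h, hh, -, hle⟩ := hM.exists_monotone_subseq strictMono_id
  exact ⟨Set.range h, Set.infinite_range_of_injective hh.injective,
    hle.imp (hM.ascendingChain_range hh) (hM.descendingChain_range hh)⟩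

/-- The element `p` belongs to no infinite chain of `M`, stated in terms of the rest of such a
chain: no infinite ascending chain lies above `p`, and no infinite descending chain below. -/
def Isolated (M : Set ℕ) (p : ℕ) : Prop :=
  (∀ E : Set ℕ, E.Infinite → AscendingChain M E → ¬ ∀ e ∈ E, Le M p e) ∧
    ∀ E : Set ℕ, E.Infinite → DescendingChain M E → ¬ ∀ e ∈ E, Le M e p

/-- A linear order does not have infinitely many isolated elements: the first term of a monotone
sequence of such elements would bound the rest. -/
theorem IsLinOrd.not_forall_isolated {M : Set ℕ} (hM : IsLinOrd M) {p : ℕ → ℕ}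
    (hp : StrictMono p) : ¬ ∀ i, Isolated M (p i) := by
  intro hiso
  obtain ⟨h, hh, hmem, hle⟩ := hM.exists_monotone_subseq hp
  obtain ⟨i, hi⟩ := hmem 0
  have hh' : StrictMono fun m => h (m + 1) := fun m n hmn => hh (by omega)
  have hinf := Set.infinite_range_of_injective hh'.injective
  rcases hle with hle | hle
  · refine (hiso i).1 _ hinf (hM.ascendingChain_range hh' fun m n hmn => hle _ _ (by omega)) ?_
    rintro _ ⟨m, rfl⟩
    exact hi ▸ hle 0 (m + 1) (by omega)
  · refine (hiso i).2 _ hinf (hM.descendingChain_range hh' fun m n hmn => hle _ _ (by omega)) ?_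
    rintro _ ⟨m, rfl⟩
    exact hi ▸ hle 0 (m + 1) (by omega)

theorem chain_union {r : ℕ → ℕ → Prop} {F E : Set ℕ} (hF : F.Finite)
    (hFE : ∀ x ∈ F, {y | y ∈ E ∧ r y x}.Finite) (hE : ∀ x ∈ E, {y | y ∈ E ∧ r y x}.Finite) :
    ∀ x ∈ F ∪ E, {y | y ∈ F ∪ E ∧ r y x}.Finite := fun x hx =>
  (hF.union (hx.elim (hFE x) (hE x))).subset fun _ hy => hy.1.imp id fun h => ⟨h, hy.2⟩

/-! ### Spoiling a pair of numbers -/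

/-- The pair `x < y` (as numbers) lies in no infinite ascending or descending sequence: `x` is on
the wrong side for the direction that `x` and `y` determine. -/
def Spoiled (L : Set ℕ) (x y : ℕ) : Prop := (Le L x y ∧ Large L x) ∨ (Le L y x ∧ Small L x)

theorem Spoiled.not_sol {L : Set ℕ} (hL : IsLinOrd L) {x y : ℕ} (h : Spoiled L x y) (hxy : x < y)
    {Y : Set ℕ} (hx : x ∈ Y) (hy : y ∈ Y) : ¬ ADS.Sol L Y := by
  rintro ⟨hinf, hY⟩
  have htail : (Y \ Set.Iio x).Infinite := hinf.sdiff (Set.finite_Iio x)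
  rcases h with ⟨hle, h⟩ | ⟨hle, h⟩
  · rcases hY with hY | hY
    · exact htail ((large_iff.1 h).subset fun z hz => hY x hx z hz.1 (not_lt.1 hz.2))
    · exact hxy.ne (hL.antisymm _ _ hle (hY x hx y hy hxy.le))
  · rcases hY with hY | hY
    · exact hxy.ne (hL.antisymm _ _ (hY x hx y hy hxy.le) hle)
    · exact htail ((small_iff.1 h).subset fun z hz => hY x hx z hz.1 (not_lt.1 hz.2))

theorem Spoiled.extends {n : ℕ} {L L' : Set ℕ} {x y : ℕ} (h : Spoiled L x y) (hx : x < n)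
    (hext : Extends n L L') : Spoiled L' x y :=
  h.imp (fun h => ⟨(hext.large x hx h.2 y).2 h.1, hext.large_of_large hx h.2⟩)
    fun h => ⟨(hext.small x hx h.2 y).2 h.1, hext.small_of_small hx h.2⟩

/-- Two pairs of the same direction can be spoiled simultaneously. -/
theorem exists_extends_spoiled {L : Set ℕ} (hL : SADS.Inst L) {n x₁ y₁ x₂ y₂ N : ℕ}
    (h₁ : x₁ ∉ committed L n) (h₂ : x₂ ∉ committed L n) (hdir : Le L x₁ y₁ ↔ Le L x₂ y₂)
    (hx₁ : x₁ < N) (hy₁ : y₁ < N) (hx₂ : x₂ < N) (hy₂ : y₂ < N) :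
    ∃ L', SADS.Inst L' ∧ Extends n L L' ∧ (∀ a < N, ∀ b < N, (Le L' a b ↔ Le L a b)) ∧
      Spoiled L' x₁ y₁ ∧ Spoiled L' x₂ y₂ := by
  by_cases hle : Le L x₁ y₁
  · have hle₂ := hdir.1 hle
    -- it suffices to make the lower one of `x₁` and `x₂` large
    obtain ⟨x, hx, hxN, hxx₁, hxx₂⟩ : ∃ x, x ∉ committed L n ∧ x < N ∧ Le L x x₁ ∧ Le L x x₂ := by
      rcases hL.1.total x₁ x₂ with h | h
      · exact ⟨x₁, h₁, hx₁, hL.1.refl _, h⟩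
      · exact ⟨x₂, h₂, hx₂, h, hL.1.refl _⟩
    obtain ⟨L', hL', hext, hag, hlarge⟩ := exists_extends_large hL hx N
    have up : ∀ z < N, Le L x z → Large L' z := fun z hz h => large_iff.2 <|
      (large_iff.1 hlarge).subset fun w hw => hL'.1.trans _ _ _ ((hag x hxN z hz).2 h) hw
    exact ⟨L', hL', hext, hag, .inl ⟨(hag _ hx₁ _ hy₁).2 hle, up _ hx₁ hxx₁⟩,
      .inl ⟨(hag _ hx₂ _ hy₂).2 hle₂, up _ hx₂ hxx₂⟩⟩
  · have hge₁ := (hL.1.total x₁ y₁).resolve_left hle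
    have hge₂ := (hL.1.total x₂ y₂).resolve_left (mt hdir.2 hle)
    obtain ⟨x, hx, hxN, hxx₁, hxx₂⟩ : ∃ x, x ∉ committed L n ∧ x < N ∧ Le L x₁ x ∧ Le L x₂ x := by
      rcases hL.1.total x₁ x₂ with h | h
      · exact ⟨x₂, h₂, hx₂, h, hL.1.refl _⟩
      · exact ⟨x₁, h₁, hx₁, hL.1.refl _, h⟩
    obtain ⟨L', hL', hext, hag, hsmall⟩ := exists_extends_small hL hx N
    have down : ∀ z < N, Le L z x → Small L' z := fun z hz h => small_iff.2 <|
      (small_iff.1 hsmall).subset fun w hw => hL'.1.trans _ _ _ hw ((hag z hz x hxN).2 h)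
    exact ⟨L', hL', hext, hag, .inr ⟨(hag _ hy₁ _ hx₁).2 hge₁, down _ hx₁ hxx₁⟩,
      .inr ⟨(hag _ hy₂ _ hx₂).2 hge₂, down _ hx₂ hxx₂⟩⟩

/-! ### Blocks -/

/-- The finite set `F`, as the part below `u` of a set `C`, makes the functional `Δ` put `x < y`
into its output, as long as `L` does not change below `u`. -/
structure IsBlock (Δ : OracleCode) (L F : Set ℕ) (u x y : ℕ) : Prop where
  nonempty : F.Nonempty
  lt_use : ∀ a ∈ F, a < u
  lt : x < y
  outputs : ∀ L' C' Y, (∀ i < u, (i ∈ L' ↔ i ∈ L)) → (∀ i < u, (i ∈ C' ↔ i ∈ F)) →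
    Δ.Computes (join L' C') Y → x ∈ Y ∧ y ∈ Y

theorem IsBlock.finite {Δ : OracleCode} {L F : Set ℕ} {u x y : ℕ} (h : IsBlock Δ L F u x y) :
    F.Finite :=
  (Set.finite_Iio u).subset h.lt_use

theorem exists_isBlock {Δ : OracleCode} {L C Y : Set ℕ} (hC : C.Infinite)
    (hΔ : Δ.Computes (join L C) Y) (hY : Y.Infinite) {A : Set ℕ} (hA : A.Finite) :
    ∃ F ⊆ C, ∃ u x y, IsBlock Δ L F u x y ∧ x ∉ A := by
  obtain ⟨x, hx, hxA⟩ := (hY.sdiff hA).nonempty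
  obtain ⟨y, hy, hxy⟩ := hY.exists_gt x
  obtain ⟨c, hc⟩ := hC.nonempty
  obtain ⟨v, hv⟩ := hΔ.exists_use (y + 1)
  refine ⟨C ∩ Set.Iio (v + c + 1), Set.inter_subset_left, v + c + 1, x, y,
    ⟨⟨c, hc, ?_⟩, fun a ha => ha.2, hxy, fun L' C' Y' hL hC' hY' => ?_⟩, hxA⟩
  · simp only [Set.mem_Iio]; omega
  · have := hv _ Y' (fun i hi => mem_join_congr (u := v) (fun j hj => hL j (by omega))
      (fun j hj => (hC' j (by omega)).trans
        ⟨fun h => h.1, fun h => ⟨h, by simp only [Set.mem_Iio]; omega⟩⟩) i hi) hY'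
    exact ⟨(this x (by omega)).2 hx, (this y (by omega)).2 hy⟩

theorem infinite_beyond {r : ℕ → ℕ → Prop} {C F : Set ℕ} (hC : C.Infinite)
    (hchain : ∀ x ∈ C, {y | y ∈ C ∧ r y x}.Finite) (hF : F.Finite) (hFC : F ⊆ C) :
    {c | c ∈ C ∧ ∀ a ∈ F, ¬ r c a}.Infinite := by
  refine (hC.sdiff (hF.biUnion fun a ha => hchain a (hFC ha))).mono fun c hc =>
    ⟨hc.1, fun a ha hr => hc.2 (Set.mem_biUnion ha ⟨hc.1, hr⟩)⟩

/-- A chain contains two successive blocks whose outputs have the same direction. The relation `r`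
is the order for an ascending chain, and its reverse for a descending chain. -/
theorem exists_two_blocks {Δ : OracleCode} {L C : Set ℕ} {r : ℕ → ℕ → Prop} (hC : C.Infinite)
    (hchain : ∀ x ∈ C, {y | y ∈ C ∧ r y x}.Finite)
    (hΔ : ∀ C' ⊆ C, C'.Infinite → ∃ Y, Δ.Computes (join L C') Y ∧ Y.Infinite)
    {A : Set ℕ} (hA : A.Finite) :
    ∃ F₁ ⊆ C, ∃ F₂ ⊆ C, ∃ u₁ x₁ y₁ u₂ x₂ y₂, IsBlock Δ L F₁ u₁ x₁ y₁ ∧ IsBlock Δ L F₂ u₂ x₂ y₂ ∧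
      x₁ ∉ A ∧ x₂ ∉ A ∧ (Le L x₁ y₁ ↔ Le L x₂ y₂) ∧ ∀ a ∈ F₁, ∀ b ∈ F₂, ¬ r b a := by
  have next : ∀ F : Set ℕ, F.Finite → F ⊆ C → ∃ G ⊆ C, ∃ u x y, IsBlock Δ L G u x y ∧ x ∉ A ∧
      ∀ a ∈ F, ∀ b ∈ G, ¬ r b a := by
    intro F hF hFC
    have hinf := infinite_beyond hC hchain hF hFC
    have hsub : {c | c ∈ C ∧ ∀ a ∈ F, ¬ r c a} ⊆ C := fun c hc => hc.1
    obtain ⟨Y, hY, hYinf⟩ := hΔ _ hsub hinf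
    obtain ⟨G, hG, u, x, y, h1, h2⟩ := exists_isBlock hinf hY hYinf hA
    exact ⟨G, hG.trans hsub, u, x, y, h1, h2, fun a ha b hb => (hG hb).2 a ha⟩
  -- among three successive blocks, two have the same direction
  obtain ⟨F, hF, u₀, x₀, y₀, h₀, hx₀, -⟩ := next ∅ Set.finite_empty (Set.empty_subset _)
  obtain ⟨G, hG, u₁, x₁, y₁, h₁, hx₁, hFG⟩ := next F h₀.finite hF
  obtain ⟨H, hH, u₂, x₂, y₂, h₂, hx₂, hFGH⟩ :=
    next (F ∪ G) (h₀.finite.union h₁.finite) (Set.union_subset hF hG)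
  by_cases e₁ : Le L x₀ y₀ ↔ Le L x₁ y₁
  · exact ⟨F, hF, G, hG, u₀, x₀, y₀, u₁, x₁, y₁, h₀, h₁, hx₀, hx₁, e₁, hFG⟩
  by_cases e₂ : Le L x₀ y₀ ↔ Le L x₂ y₂
  · exact ⟨F, hF, H, hH, u₀, x₀, y₀, u₂, x₂, y₂, h₀, h₂, hx₀, hx₂, e₂,
      fun a ha => hFGH a (.inl ha)⟩
  · exact ⟨G, hG, H, hH, u₁, x₁, y₁, u₂, x₂, y₂, h₁, h₂, hx₁, hx₂, by tauto,
      fun a ha => hFGH a (.inr ha)⟩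

/-! ### Forcing isolated elements -/

/-- `Φ` and `Δ` witness that `SADS` is Weihrauch reducible to `ADC`. -/
def IsReduction (Φ Δ : OracleCode) : Prop :=
  ∀ X, SADS.Inst X → ∃ X', Φ.Computes X X' ∧ ADC.Inst X' ∧
    ∀ Y', ADC.Sol X' Y' → ∃ Y, Δ.Computes (join X Y') Y ∧ SADS.Sol X Y

/-- If the pair that a block outputs is spoiled, then no solution agrees with the block below its
use. -/
theorem IsReduction.not_sol {Φ Δ : OracleCode} (hred : IsReduction Φ Δ) {L L' M F S : Set ℕ}
    {u x y : ℕ} (hB : IsBlock Δ L F u x y) (hL' : SADS.Inst L') (hM : Φ.Computes L' M)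
    (hag : ∀ i < u, (i ∈ L' ↔ i ∈ L)) (hS : ∀ i < u, (i ∈ S ↔ i ∈ F)) (hsp : Spoiled L' x y) :
    ¬ ADC.Sol M S := by
  intro hsol
  obtain ⟨M', hM', -, h⟩ := hred L' hL'
  obtain rfl := hM.unique hM'
  obtain ⟨Y, hY, hYsol⟩ := h S hsol
  obtain ⟨hx, hy⟩ := hB.outputs L' S Y hag hS hY
  exact hsp.not_sol hL'.1 hB.lt hx hy hYsol

/-- Two blocks as in `exists_two_blocks`, arranged so that the first lies below the second in
`Φ^L`, whether they come from an ascending or from a descending chain. -/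
theorem IsReduction.exists_blocks {Φ Δ : OracleCode} (hred : IsReduction Φ Δ) {L M : Set ℕ}
    (hL : SADS.Inst L) (hM : Φ.Computes L M) (hMlin : IsLinOrd M) (k : ℕ) {A : Set ℕ}
    (hA : A.Finite) :
    ∃ F₁ F₂ : Set ℕ, ∃ u₁ x₁ y₁ u₂ x₂ y₂, IsBlock Δ L F₁ u₁ x₁ y₁ ∧ IsBlock Δ L F₂ u₂ x₂ y₂ ∧
      x₁ ∉ A ∧ x₂ ∉ A ∧ (Le L x₁ y₁ ↔ Le L x₂ y₂) ∧ (∀ a ∈ F₁, k ≤ a) ∧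
      ∀ a ∈ F₁, ∀ b ∈ F₂, Le M a b := by
  obtain ⟨M', hM', -, hsol⟩ := hred L hL
  obtain rfl := hM.unique hM'
  obtain ⟨C, hCinf, hC⟩ := hMlin.exists_adc_sol
  have hinf : (C \ Set.Iio k).Infinite := hCinf.sdiff (Set.finite_Iio k)
  have hsubset : ∀ C' ⊆ C, AscendingChain M C ∨ DescendingChain M C →
      AscendingChain M C' ∨ DescendingChain M C' := fun C' hC' h => h.imp
    (fun h x hx => (h x (hC' hx)).subset fun y hy => ⟨hC' hy.1, hy.2⟩)
    (fun h x hx => (h x (hC' hx)).subset fun y hy => ⟨hC' hy.1, hy.2⟩)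
  have hΔ : ∀ C' ⊆ C \ Set.Iio k, C'.Infinite → ∃ Y, Δ.Computes (join L C') Y ∧ Y.Infinite := by
    intro C' hC' hCi
    obtain ⟨Y, hY, hYsol⟩ := hsol C' ⟨hCi, hsubset C' (hC'.trans Set.sdiff_subset) hC⟩
    exact ⟨Y, hY, hYsol.1⟩
  rcases hC with hC | hC
  · have hchain : ∀ x ∈ C \ Set.Iio k, {y | y ∈ C \ Set.Iio k ∧ Le M y x}.Finite :=
      fun x hx => (hC x hx.1).subset fun y hy => ⟨hy.1.1, hy.2⟩
    obtain ⟨F₁, hF₁, F₂, hF₂, u₁, x₁, y₁, u₂, x₂, y₂, h₁, h₂, hx₁, hx₂, hdir, hr⟩ :=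
      exists_two_blocks hinf hchain hΔ hA
    exact ⟨F₁, F₂, u₁, x₁, y₁, u₂, x₂, y₂, h₁, h₂, hx₁, hx₂, hdir,
      fun a ha => not_lt.1 (hF₁ ha).2,
      fun a ha b hb => (hMlin.total a b).resolve_right (hr a ha b hb)⟩
  · have hchain : ∀ x ∈ C \ Set.Iio k, {y | y ∈ C \ Set.Iio k ∧ Le M x y}.Finite :=
      fun x hx => (hC x hx.1).subset fun y hy => ⟨hy.1.1, hy.2⟩
    obtain ⟨F₂, hF₂, F₁, hF₁, u₂, x₂, y₂, u₁, x₁, y₁, h₂, h₁, hx₂, hx₁, hdir, hr⟩ :=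
      exists_two_blocks (r := fun y x => Le M x y) hinf hchain hΔ hA
    exact ⟨F₁, F₂, u₁, x₁, y₁, u₂, x₂, y₂, h₁, h₂, hx₁, hx₂, hdir.symm,
      fun a ha => not_lt.1 (hF₁ ha).2,
      fun a ha b hb => (hMlin.total a b).resolve_right (hr b hb a ha)⟩

/-- Below every finite amount of commitments, some late number can be forced to be isolated in the
order computed by `Φ`: it is the greatest element of the lower one of two successive blocks, both
of which have been spoiled. -/
theorem IsReduction.exists_forces_isolated {Φ Δ : OracleCode} (hred : IsReduction Φ Δ) {L : Set ℕ}
    (hL : SADS.Inst L) (n : ℕ) :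
    ∃ L' N p, SADS.Inst L' ∧ Extends n L L' ∧ n ≤ p ∧
      ∀ L'' M, SADS.Inst L'' → Extends N L' L'' → Φ.Computes L'' M → IsLinOrd M →
        Isolated M p := by
  obtain ⟨M, hM, hMlin, -⟩ := hred L hL
  obtain ⟨F₁, F₂, u₁, x₁, y₁, u₂, x₂, y₂, h₁, h₂, hx₁, hx₂, hdir, hk, hF⟩ :=
    hred.exists_blocks hL hM hMlin n (committed_finite L n)
  obtain ⟨p, hp, hpmax⟩ := hMlin.exists_greatest h₁.finite h₁.nonempty
  -- the values of `Φ` that determine the order of the numbers below `u₁ + u₂`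
  obtain ⟨v, hv⟩ := hM.exists_use ((u₁ + u₂ + 1) ^ 2)
  obtain ⟨N, hN⟩ : ∃ N, N = u₁ + u₂ + v + x₁ + y₁ + x₂ + y₂ + 1 := ⟨_, rfl⟩
  obtain ⟨L', hL', hext, hag, hsp₁, hsp₂⟩ := exists_extends_spoiled (N := N) hL hx₁ hx₂ hdir
    (by omega) (by omega) (by omega) (by omega)
  refine ⟨L', N, p, hL', hext, hk p hp, fun L'' M'' hL'' hext' hM'' hlin => ?_⟩
  have hbits : ∀ i < N, (i ∈ L'' ↔ i ∈ L) := by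
    intro i hi
    rw [hext'.mem_iff hL' hL'' hi]
    simpa only [Le, Nat.pair_unpair] using hag _ ((Nat.unpair_left_le i).trans_lt hi) _
      ((Nat.unpair_right_le i).trans_lt hi)
  have hle : ∀ a < u₁ + u₂, ∀ b < u₁ + u₂, Le M a b → Le M'' a b := by
    intro a ha b hb h
    refine (hv L'' M'' (fun i hi => hbits i (by omega)) hM'' _ ?_).2 h
    exact (Nat.pair_lt_max_add_one_sq a b).trans_le (Nat.pow_le_pow_left (by omega) 2)
  have hlt₁ : ∀ a ∈ F₁, a < u₁ + u₂ := fun a ha => (h₁.lt_use a ha).trans_le (by omega)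
  have hlt₂ : ∀ a ∈ F₂, a < u₁ + u₂ := fun a ha => (h₂.lt_use a ha).trans_le (by omega)
  have hS : ∀ {F E : Set ℕ} {u : ℕ}, (∀ a ∈ F, a < u) →
      ∀ i < u, (i ∈ F ∪ (E \ Set.Iio u) ↔ i ∈ F) := fun _ i hi =>
    ⟨fun h => h.resolve_right fun h' => h'.2 hi, .inl⟩
  constructor
  -- `E` would extend the lower block to an ascending chain
  · intro E hE hchain hpE
    refine hred.not_sol h₁ hL'' hM'' (fun i hi => hbits i (by omega)) (hS (E := E) h₁.lt_use)
      (hsp₁.extends (by omega) hext')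
      ⟨(hE.sdiff (Set.finite_Iio u₁)).mono Set.subset_union_right, .inl ?_⟩
    refine chain_union (r := Le M'') h₁.finite (fun x hx => ?_) fun x hx =>
      (hchain x hx.1).subset fun y hy => ⟨hy.1.1, hy.2⟩
    refine (Set.finite_singleton p).subset fun y hy => ?_
    exact hlin.antisymm y p
      (hlin.trans _ _ _ hy.2 (hle x (hlt₁ x hx) p (hlt₁ p hp) (hpmax x hx))) (hpE y hy.1.1)
  -- `E` would extend the upper block to a descending chain
  · intro E hE hchain hpE
    refine hred.not_sol h₂ hL'' hM'' (fun i hi => hbits i (by omega)) (hS (E := E) h₂.lt_use)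
      (hsp₂.extends (by omega) hext')
      ⟨(hE.sdiff (Set.finite_Iio u₂)).mono Set.subset_union_right, .inr ?_⟩
    refine chain_union (r := fun y x => Le M'' x y) h₂.finite (fun x hx => ?_) fun x hx =>
      (hchain x hx.1).subset fun y hy => ⟨hy.1.1, hy.2⟩
    refine (Set.finite_singleton p).subset fun y hy => ?_
    exact hlin.antisymm y p (hpE y hy.1.1)
      (hlin.trans _ _ _ (hle p (hlt₁ p hp) x (hlt₂ x hx) (hF p hp x hx)) hy.2)

theorem sads_not_weihrauchReducible_adc : ¬ WeihrauchReducible SADS ADC := by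
  rintro ⟨Φ, Δ, hred⟩
  replace hred : IsReduction Φ Δ := hred
  have step : ∀ s : {s : Set ℕ × ℕ // SADS.Inst s.1}, ∃ t : {s : Set ℕ × ℕ // SADS.Inst s.1},
      ∃ p, s.1.2 ≤ p ∧ p < t.1.2 ∧ s.1.2 < t.1.2 ∧ Extends s.1.2 s.1.1 t.1.1 ∧
        (∃ a, s.1.2 ≤ a ∧ a < t.1.2 ∧ Small t.1.1 a) ∧
        (∃ a, s.1.2 ≤ a ∧ a < t.1.2 ∧ Large t.1.1 a) ∧
        ∀ K M, SADS.Inst K → Extends t.1.2 t.1.1 K → Φ.Computes K M → IsLinOrd M →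
          Isolated M p := by
    rintro ⟨⟨L, n⟩, hL⟩
    obtain ⟨L', N, p, hL', hext, hnp, hforce⟩ := hred.exists_forces_isolated hL n
    obtain ⟨a, ha, han⟩ := hL'.2.2.1.exists_gt n
    obtain ⟨b, hb, hbn⟩ := hL'.2.2.2.exists_gt n
    refine ⟨⟨⟨L', N + n + p + a + b + 1⟩, hL'⟩, p, hnp, ?_, ?_, hext, ⟨a, han.le, ?_, ha⟩,
      ⟨b, hbn.le, ?_, hb⟩, fun K M hK hKext => hforce K M hK
        ((Extends.refl N L').trans hKext ?_)⟩ <;> dsimp only <;> omega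
  choose f g hfg using step
  obtain ⟨L₀, hL₀⟩ := exists_sads_inst
  let seq : ℕ → {s : Set ℕ × ℕ // SADS.Inst s.1} := fun i => f^[i] ⟨(L₀, 0), hL₀⟩
  have hseq : ∀ i, seq (i + 1) = f (seq i) := fun i => Function.iterate_succ_apply' f i _
  obtain ⟨K, hK, hKext⟩ := exists_limit (L := fun i => (seq i).1.1) (n := fun i => (seq i).1.2)
    (fun i => (seq i).2) (fun i => by rw [hseq]; exact (hfg (seq i)).2.2.1)
    (fun i => by rw [hseq]; exact (hfg (seq i)).2.2.2.1)
    (fun i => by rw [hseq]; exact (hfg (seq i)).2.2.2.2.1)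
    (fun i => by rw [hseq]; exact (hfg (seq i)).2.2.2.2.2.1)
  obtain ⟨M, hM, hMlin, -⟩ := hred K hK
  have hMlin : IsLinOrd M := hMlin
  refine hMlin.not_forall_isolated (p := fun i => g (seq i)) (strictMono_nat_of_lt_succ fun i => ?_)
    fun i => ?_
  · have h1 := (hfg (seq i)).2.1
    have h2 := (hfg (seq (i + 1))).1
    rw [hseq] at h2 ⊢
    exact h1.trans_le h2
  · refine (hfg (seq i)).2.2.2.2.2.2 K M hK ?_ hM hMlin
    rw [← hseq]
    exact hKext (i + 1)

end Weihrauch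

theorem mainTheorem1 :
    ¬ Weihrauch.WeihrauchReducible Weihrauch.SADS Weihrauch.ADC ∧
    ¬ Weihrauch.WeihrauchReducible Weihrauch.ADS Weihrauch.ADC ∧
    Weihrauch.ComputablyReducible Weihrauch.ADS Weihrauch.ADC ∧
    Weihrauch.ComputablyReducible Weihrauch.ADC Weihrauch.ADS := by
  refine ⟨Weihrauch.sads_not_weihrauchReducible_adc, ?_, Weihrauch.ads_computablyReducible_adc,
    Weihrauch.adc_computablyReducible_ads⟩
  rintro ⟨Φ, Δ, h⟩
  exact Weihrauch.sads_not_weihrauchReducible_adc ⟨Φ, Δ, fun X hX => h X hX.1⟩
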